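/- All graphs are finite, simple and undirected. A graph $G$ is $(k,d)$-colourable if its vertices can be coloured with $k$ colours so that every vertex has at most $d$ neighbours of its own colour. A graph $H$ is a minor of $G$ if a graph isomorphic to $H$ can be obtained from a subgraph of $G$ by contracting edges; otherwise $G$ is $H$-minor-free. Let $f(H)$ be the defective chromatic number of the class of $H$-minor-free graphs, that is, the minimum integer $k\ge 0$ for which there is an integer $d\geq 0$ such that every $H$-minor-free graph is $(k,d)$-colourable. Let $\tau(H)$ be the vertex cover number of $H$, the minimum size of a set of vertices that meets every edge of $H$. For a connected graph $H$, the tree-depth $\mathrm{td}(H)$ is the minimum height of a rooted tree $T$ such that $H$ is a subgraph of the closure of $T$, where the height of $T$ is the maximum number of vertices on a root-to-leaf path, and the closure of $T$ is obtained by adding an edge between every ancestor and descendant. For a general graph $H$, $\mathrm{td}(H)$ is the maximum tree-depth of the connected components of $H$ (and $0$ if $H$ has no vertices). **Proposition.** For every graph $H$, the number $f(H)$ exists and satisfies $$\mathrm{td}(H)-1\le f(H).$$ If moreover $H$ has at least one edge or at most one vertex, then $$f(H)\le\tau(H).$$ -/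

import Mathlib

universe u

namespace SimpleGraph

/-- `G` is `(k,d)`-colourable: the vertices can be coloured with `k` colours so that every vertex
has at most `d` neighbours of its own colour. -/
def DefectiveColorable {V : Type u} (G : SimpleGraph V) (k d : ℕ) : Prop :=
  ∃ c : V → Fin k, ∀ v : V, {w : V | G.Adj v w ∧ c w = c v}.encard ≤ d

/-- `H` is isomorphic to a graph obtained from `G` by contracting edges. The fibres of `π` are the
connected vertex sets that are contracted to single vertices; loops and parallel edges are
discarded. (`Connected` includes non-emptiness, so `π` is surjective.) -/
def IsContractionOf {W V : Type u} (H : SimpleGraph W) (G : SimpleGraph V) : Prop :=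
  ∃ π : V → W,
    (∀ w : W, (G.induce {x : V | π x = w}).Connected) ∧
    ∀ a b : W, H.Adj a b ↔ a ≠ b ∧ ∃ x y : V, π x = a ∧ π y = b ∧ G.Adj x y

/-- `H` is a minor of `G`: a graph isomorphic to `H` can be obtained from a subgraph of `G` by
contracting edges. -/
def IsMinorOf {W V : Type u} (H : SimpleGraph W) (G : SimpleGraph V) : Prop :=
  ∃ G' : G.Subgraph, H.IsContractionOf G'.coe

/-- In the tree `T` rooted at `r`, the vertex `a` is an ancestor of `b` (possibly `a = b`):
`a` lies on the path from `r` to `b`. -/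
def IsAncestor {N : Type u} (T : SimpleGraph N) (r a b : N) : Prop :=
  ∃ p : T.Walk r b, p.IsPath ∧ a ∈ p.support

/-- The closure of the tree `T` rooted at `r`: distinct vertices are adjacent exactly when one is
an ancestor of the other. -/
def rootedClosure {N : Type u} (T : SimpleGraph N) (r : N) : SimpleGraph N :=
  SimpleGraph.fromRel (T.IsAncestor r)

/-- The height of the finite tree `T` rooted at `r`: the maximum number of vertices on a path from
the root to a vertex (a longest such path ends at a leaf). -/
noncomputable def rootedHeight {N : Type u} (T : SimpleGraph N) (r : N) : ℕ :=
  ⨆ v : N, (T.dist r v + 1)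

/-- The tree-depth of a finite connected graph `H`: the minimum height of a rooted tree whose
closure contains `H` as a subgraph. -/
noncomputable def connectedTreeDepth {V : Type u} (H : SimpleGraph V) : ℕ :=
  sInf {h : ℕ | ∃ (N : Type u) (_ : Finite N) (T : SimpleGraph N) (r : N),
    T.IsTree ∧ H.IsContained (T.rootedClosure r) ∧ T.rootedHeight r = h}

/-- The tree-depth of a finite graph: the maximum tree-depth of its connected components
(`0` for the graph without vertices). -/
noncomputable def treeDepth {V : Type u} (H : SimpleGraph V) : ℕ :=
  ⨆ C : H.ConnectedComponent, C.toSimpleGraph.connectedTreeDepth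

end SimpleGraph

/-- A class of graphs, as a predicate on simple graphs. -/
def GraphClass : Type (u + 1) := (V : Type u) → SimpleGraph V → Prop

/-- `k` is the defective chromatic number of the class of finite graphs `𝒞`: the minimum `k` for
which there is a `d` such that every finite graph in `𝒞` is `(k,d)`-colourable. -/
def IsDefectiveChromaticNumber (𝒞 : GraphClass.{u}) (k : ℕ) : Prop :=
  IsLeast {k : ℕ | ∃ d : ℕ, ∀ (V : Type u) [Finite V] (G : SimpleGraph V),
    𝒞 V G → G.DefectiveColorable k d} k

/-- The class of `H`-minor-free graphs. -/
def minorFreeClass {W : Type u} (H : SimpleGraph W) : GraphClass.{u} :=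
  fun _ G => ¬ H.IsMinorOf G

/-!
*Lower bound.* In the closure of the complete `(d + 1)`-ary tree with `k + 1` levels, every
connected set has a vertex that is an ancestor of all the others. Sending each branch set to this
vertex shows that the minors of the closure are subgraphs of it, so they have tree-depth at most
`k + 1`. The closure is not `(k, d)`-colourable: if every vertex has at most `d` descendants of its
own colour, then some child of it has no such descendant-or-self, so descending from the root one
finds a path with `k + 1` different colours.

*Upper bound.* Let `C` be a nonempty vertex cover of `H`. It suffices that a nonempty `H`-minor-free
graph has a vertex of degree less than `|C|`, which can be coloured last, or an edge whose ends both
have bounded degree, which can be ignored. Otherwise the vertices of low degree form an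
independent set `A`. Contract as many edges at vertices of `A` as possible such that each one
creates a new edge between vertices outside `A`. The number of contracted vertices is at most linear
in `|Aᶜ|` because the contracted graph is sparse; the neighbourhood of every other vertex of `A` has
become a clique. A sparse graph has linearly many cliques, and each of them is the neighbourhood of
fewer than `|H|` vertices of `A`, as `C` embeds into the clique and the rest of `H` into these
vertices. Hence `|A|` is linear in `|Aᶜ|`, and the degrees in `Aᶜ` contradict the sparsity of the
graph.
-/

open Function SimpleGraph

/-! ### Minor models -/

/-- The sets `B w` are the branch sets of a model of `H` as a minor of `G`. -/
structure IsMinorModel {W V : Type*} (H : SimpleGraph W) (G : SimpleGraph V)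
    (B : W → Set V) : Prop where
  connected : ∀ w, (G.induce (B w)).Connected
  disjoint : Pairwise (Disjoint on B)
  exists_adj : ∀ a b, H.Adj a b → ∃ x ∈ B a, ∃ y ∈ B b, G.Adj x y

/-- `H` is a minor of `G`, witnessed by branch sets. Unlike `SimpleGraph.IsMinorOf`, this relates
graphs on vertex types in different universes. -/
def HasMinorModel {W V : Type*} (H : SimpleGraph W) (G : SimpleGraph V) : Prop :=
  ∃ B : W → Set V, IsMinorModel H G B

theorem connected_induce_iUnion {ι V : Type*} {F : SimpleGraph ι} {G : SimpleGraph V}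
    {C : ι → Set V} (hF : F.Connected) (hC : ∀ i, (G.induce (C i)).Connected)
    (hadj : ∀ i j, F.Adj i j → ∃ x ∈ C i, ∃ y ∈ C j, G.Adj x y) :
    (G.induce (⋃ i, C i)).Connected := by
  have mem {i x} (hx : x ∈ C i) : x ∈ ⋃ i, C i := Set.mem_iUnion_of_mem i hx
  have reach_within {i x y} (hx : x ∈ C i) (hy : y ∈ C i) :
      (G.induce (⋃ i, C i)).Reachable ⟨x, mem hx⟩ ⟨y, mem hy⟩ :=
    ((hC i).preconnected ⟨x, hx⟩ ⟨y, hy⟩).map (induceHomOfLE G (Set.subset_iUnion C i)).toHom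
  have reach_along {i j} (p : F.Walk i j) : ∀ {x y} (hx : x ∈ C i) (hy : y ∈ C j),
      (G.induce (⋃ i, C i)).Reachable ⟨x, mem hx⟩ ⟨y, mem hy⟩ := by
    induction p with
    | nil => exact reach_within
    | cons hij _ ih =>
      intro x y hx hy
      obtain ⟨u, hu, v, hv, huv⟩ := hadj _ _ hij
      have huv' : (G.induce (⋃ i, C i)).Adj ⟨u, mem hu⟩ ⟨v, mem hv⟩ := huv
      exact (reach_within hx hu).trans (huv'.reachable.trans (ih hv hy))
  obtain ⟨i⟩ := hF.nonempty
  obtain ⟨⟨x, hx⟩⟩ := (hC i).nonempty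
  refine connected_iff_exists_forall_reachable _ |>.2 ⟨⟨x, mem hx⟩, fun ⟨y, hy⟩ => ?_⟩
  obtain ⟨j, hy⟩ := Set.mem_iUnion.1 hy
  obtain ⟨p⟩ := hF.preconnected i j
  exact reach_along p hx hy

theorem connected_induce_singleton {V : Type*} (G : SimpleGraph V) (x : V) :
    (G.induce {x}).Connected :=
  ⟨fun a b => by rw [Subsingleton.elim a b]⟩

theorem connected_induce_of_forall_adj {V : Type*} {G : SimpleGraph V} {S : Set V} {x : V}
    (hx : x ∈ S) (h : ∀ y ∈ S, y = x ∨ G.Adj x y) : (G.induce S).Connected := by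
  refine connected_iff_exists_forall_reachable _ |>.2 ⟨⟨x, hx⟩, fun ⟨y, hy⟩ => ?_⟩
  obtain rfl | hxy := h y hy
  · rfl
  · exact Adj.reachable (G := G.induce S) hxy

namespace HasMinorModel

variable {U V W : Type*} {F : SimpleGraph U} {G : SimpleGraph V} {H : SimpleGraph W}

theorem of_isContained (h : H ⊑ G) : HasMinorModel H G := by
  obtain ⟨f⟩ := h
  exact ⟨fun w => {f w},
    { connected := fun w => connected_induce_singleton G (f w)
      disjoint := fun _ _ hab => Set.disjoint_singleton.2 (f.injective.ne hab)
      exists_adj := fun a b hab => ⟨f a, rfl, f b, rfl, f.toHom.map_adj hab⟩ }⟩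

theorem trans (hFH : HasMinorModel F H) (hHG : HasMinorModel H G) : HasMinorModel F G := by
  obtain ⟨B, hB⟩ := hFH
  obtain ⟨C, hC⟩ := hHG
  refine ⟨fun u => ⋃ x : B u, C x, ⟨fun u => ?_, fun a b hab => ?_, fun a b hab => ?_⟩⟩
  · exact connected_induce_iUnion (hB.connected u) (fun x => hC.connected x)
      fun x y hxy => hC.exists_adj x y hxy
  · simp only [onFun, Set.disjoint_iUnion_left, Set.disjoint_iUnion_right]
    exact fun y x => hC.disjoint ((hB.disjoint hab).ne_of_mem x.2 y.2)
  · obtain ⟨x, hx, y, hy, hxy⟩ := hB.exists_adj a b hab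
    obtain ⟨x', hx', y', hy', hxy'⟩ := hC.exists_adj x y hxy
    exact ⟨x', Set.mem_iUnion_of_mem ⟨x, hx⟩ hx', y', Set.mem_iUnion_of_mem ⟨y, hy⟩ hy', hxy'⟩

theorem induce_mono {s t : Set V} (h : HasMinorModel H (G.induce s)) (hst : s ⊆ t) :
    HasMinorModel H (G.induce t) :=
  h.trans (of_isContained ⟨(induceHomOfLE G hst).toCopy⟩)

theorem of_induce_neighborSet {x : V}
    (h : HasMinorModel (⊤ : SimpleGraph W) (G.induce (G.neighborSet x))) :
    HasMinorModel (⊤ : SimpleGraph (Option W)) G := by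
  obtain ⟨B, hB⟩ := h
  have connected_image (w : W) : (G.induce (Subtype.val '' B w)).Connected :=
    (hB.connected w).map
      (⟨fun y => ⟨y.1, Set.mem_image_of_mem _ y.2⟩, fun hyz => hyz⟩ :
        (G.induce (G.neighborSet x)).induce (B w) →g G.induce (Subtype.val '' B w))
      (by rintro ⟨-, y, hy, rfl⟩; exact ⟨⟨y, hy⟩, rfl⟩)
  have disjoint_singleton (w : W) : Disjoint {x} (Subtype.val '' B w) := by
    rw [Set.disjoint_singleton_left]
    rintro ⟨y, -, hyx⟩
    exact G.ne_of_adj y.2 hyx.symm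
  have exists_adj_singleton (w : W) : ∃ y ∈ Subtype.val '' B w, G.Adj x y := by
    obtain ⟨⟨y, hy⟩⟩ := (hB.connected w).nonempty
    exact ⟨y, Set.mem_image_of_mem _ hy, y.2⟩
  refine ⟨fun w => w.elim {x} fun w => Subtype.val '' B w, ?_, ?_, ?_⟩
  · rintro (_ | w)
    exacts [connected_induce_singleton G x, connected_image w]
  · rintro (_ | a) (_ | b) hab
    · exact absurd rfl hab
    · exact disjoint_singleton b
    · exact (disjoint_singleton a).symm
    · exact Set.disjoint_image_iff Subtype.val_injective |>.2
        (hB.disjoint fun h => hab (congrArg some h))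
  · rintro (_ | a) (_ | b) hab
    · exact absurd rfl hab.ne
    · obtain ⟨y, hy, hxy⟩ := exists_adj_singleton b
      exact ⟨x, rfl, y, hy, hxy⟩
    · obtain ⟨y, hy, hxy⟩ := exists_adj_singleton a
      exact ⟨y, hy, x, rfl, hxy.symm⟩
    · obtain ⟨y, hy, z, hz, hyz⟩ := hB.exists_adj a b fun h => hab.ne (congrArg some h)
      exact ⟨y, Set.mem_image_of_mem _ hy, z, Set.mem_image_of_mem _ hz, hyz⟩

end HasMinorModel

theorem HasMinorModel.isMinorOf {W V : Type u} {H : SimpleGraph W} {G : SimpleGraph V}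
    (h : HasMinorModel H G) : H.IsMinorOf G := by
  obtain ⟨B, hB⟩ := h
  let G' : G.Subgraph :=
    { verts := ⋃ w, B w
      Adj := fun x y => G.Adj x y ∧ ∃ a b, x ∈ B a ∧ y ∈ B b ∧ (a = b ∨ H.Adj a b)
      adj_sub := And.left
      edge_vert := fun ⟨_, a, _, ha, _⟩ => Set.mem_iUnion_of_mem a ha
      symm := ⟨fun x y ⟨hxy, a, b, ha, hb, hab⟩ =>
        ⟨hxy.symm, b, a, hb, ha, hab.imp Eq.symm Adj.symm⟩⟩ }
  choose π hπ using fun x : G'.verts => Set.mem_iUnion.1 x.2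
  have π_eq (x : G'.verts) {w} (hw : (x : V) ∈ B w) : π x = w :=
    by_contra fun hne => (hB.disjoint hne).ne_of_mem (hπ x) hw rfl
  have mem {x w} (hx : x ∈ B w) : x ∈ G'.verts := Set.mem_iUnion_of_mem w hx
  refine ⟨G', π, fun w => ?_, fun a b => ⟨fun hab => ?_, ?_⟩⟩
  · let φ : G.induce (B w) →g G'.coe.induce {x | π x = w} :=
      { toFun := fun x => ⟨⟨x, mem x.2⟩, π_eq _ x.2⟩
        map_rel' := fun {x y} hxy => ⟨hxy, w, w, x.2, y.2, Or.inl rfl⟩ }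
    refine (hB.connected w).map φ ?_
    rintro ⟨x, rfl⟩
    exact ⟨⟨x, hπ x⟩, rfl⟩
  · obtain ⟨x, hx, y, hy, hxy⟩ := hB.exists_adj a b hab
    exact ⟨hab.ne, ⟨x, mem hx⟩, ⟨y, mem hy⟩, π_eq _ hx, π_eq _ hy, hxy, a, b, hx, hy, Or.inr hab⟩
  · rintro ⟨hne, x, y, rfl, rfl, -, a, b, ha, hb, hab⟩
    rw [π_eq x ha, π_eq y hb] at hne ⊢
    exact hab.resolve_left hne

theorem hasMinorModel_of_isMinorOf {W V : Type u} {H : SimpleGraph W} {G : SimpleGraph V}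
    (h : H.IsMinorOf G) : HasMinorModel H G := by
  obtain ⟨G', π, hconn, hadj⟩ := h
  have hmodel : HasMinorModel H G'.coe :=
    ⟨fun w => {x | π x = w}, hconn,
      fun a b hab => Set.disjoint_left.2 fun x hxa hxb => hab (hxa.symm.trans hxb),
      fun a b hab => by
        obtain ⟨-, x, y, hx, hy, hxy⟩ := (hadj a b).1 hab
        exact ⟨x, hx, y, hy, hxy⟩⟩
  exact hmodel.trans (.of_isContained ⟨G'.hom.toCopy Subtype.val_injective⟩)

/-! ### Suffix graphs -/

/-- The words over `α` of length at most `n`, serving as the vertices of the complete `α`-ary tree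
with `n + 1` levels; the parent of a word is its tail. -/
abbrev BoundedWord (α : Type*) (n : ℕ) := {l : List α // l.length ≤ n}

namespace BoundedWord

variable {α W : Type*} {n : ℕ}

instance [Finite α] : Finite (BoundedWord α n) := (List.finite_length_le α n).to_subtype

/-- The empty word, as the root of the tree of words. -/
def root (α : Type*) (n : ℕ) : BoundedWord α n := ⟨[], n.zero_le⟩

/-- The parent of a word in the tree of words; the root is its own parent. -/
def parent (x : BoundedWord α n) : BoundedWord α n :=
  ⟨x.1.tail, x.1.tail_suffix.length_le.trans x.2⟩

/-- The complete `α`-ary tree with `n + 1` levels. -/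
def tree (α : Type*) (n : ℕ) : SimpleGraph (BoundedWord α n) :=
  fromRel fun x y => y.parent = x

/-- The closure of the complete `α`-ary tree with `n + 1` levels: the ancestors of a word are its
suffixes. -/
def suffixGraph (α : Type*) (n : ℕ) : SimpleGraph (BoundedWord α n) :=
  fromRel fun x y => x.1 <:+ y.1

theorem exists_isPath_root : ∀ x : BoundedWord α n, ∃ p : (tree α n).Walk x (root α n),
    p.IsPath ∧ p.length = x.1.length ∧ ∀ y, y ∈ p.support ↔ y.1 <:+ x.1
  | ⟨[], _⟩ => ⟨.nil, .nil, rfl, fun y => by simp [root, Subtype.ext_iff]⟩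
  | ⟨a :: l, h⟩ => by
    obtain ⟨p, hp, hlen, hsupp⟩ := exists_isPath_root ⟨l, (Nat.le_succ _).trans h⟩
    have hadj : (tree α n).Adj ⟨a :: l, h⟩ ⟨l, (Nat.le_succ _).trans h⟩ :=
      ⟨fun h => List.cons_ne_self a l (congrArg Subtype.val h), Or.inr rfl⟩
    refine ⟨.cons hadj p, ?_, by simp [hlen], fun y => ?_⟩
    · rw [Walk.cons_isPath_iff, hsupp]
      exact ⟨hp, fun h => absurd h.length_le (by simp)⟩
    · rw [Walk.support_cons, List.mem_cons, hsupp, List.suffix_cons_iff, Subtype.ext_iff]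

theorem connected_tree (α : Type*) (n : ℕ) : (tree α n).Connected :=
  connected_iff_exists_forall_reachable _ |>.2
    ⟨root α n, fun x => (exists_isPath_root x).choose.reachable.symm⟩

theorem edgeSet_tree_subset :
    (tree α n).edgeSet ⊆ (fun x => s(x.parent, x)) '' {root α n}ᶜ := by
  have parent_root : (root α n).parent = root α n := rfl
  refine fun e => e.ind ?_
  rintro x y ⟨hne : x ≠ y, (hxy : y.parent = x) | (hyx : x.parent = y)⟩
  · exact ⟨y, fun h => hne (by rw [← hxy, Set.mem_singleton_iff.1 h, parent_root]), by simp [hxy]⟩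
  · exact ⟨x, fun h => hne (by rw [← hyx, Set.mem_singleton_iff.1 h, parent_root]),
      by simp [hyx, Sym2.eq_swap]⟩

theorem isTree_tree (α : Type*) [Finite α] (n : ℕ) : (tree α n).IsTree := by
  refine isTree_iff_connected_and_card.2 ⟨connected_tree α n, le_antisymm ?_
    (connected_tree α n).card_vert_le_card_edgeSet_add_one⟩
  calc Nat.card (tree α n).edgeSet + 1
      = (tree α n).edgeSet.ncard + 1 := rfl
    _ ≤ ({root α n}ᶜ : Set (BoundedWord α n)).ncard + 1 := by
      gcongr
      exact (Set.ncard_le_ncard edgeSet_tree_subset).trans (Set.ncard_image_le)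
    _ = Nat.card (BoundedWord α n) := by
      rw [add_comm, ← Set.ncard_singleton (root α n), Set.ncard_add_ncard_compl]

theorem rootedHeight_tree_le : (tree α n).rootedHeight (root α n) ≤ n + 1 := by
  refine ciSup_le' fun x => ?_
  obtain ⟨p, -, hlen, -⟩ := exists_isPath_root x
  rw [dist_comm]
  exact Nat.succ_le_succ ((dist_le p).trans (hlen.trans_le x.2))

theorem suffixGraph_le_rootedClosure :
    suffixGraph α n ≤ (tree α n).rootedClosure (root α n) := by
  have isAncestor {x y : BoundedWord α n} (h : x.1 <:+ y.1) :
      (tree α n).IsAncestor (root α n) x y := by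
    obtain ⟨p, hp, -, hsupp⟩ := exists_isPath_root y
    exact ⟨p.reverse, hp.reverse, by rw [Walk.support_reverse, List.mem_reverse, hsupp]; exact h⟩
  exact fun x y ⟨hne, h⟩ => ⟨hne, h.imp isAncestor isAncestor⟩

theorem exists_suffix_of_connected {S : Set (BoundedWord α n)}
    (hS : ((suffixGraph α n).induce S).Connected) : ∃ x ∈ S, ∀ y ∈ S, x.1 <:+ y.1 := by
  obtain ⟨⟨s, hs⟩⟩ := hS.nonempty
  obtain ⟨x, hx, hmin⟩ := (measure fun x : BoundedWord α n => x.1.length).wf.has_min S ⟨s, hs⟩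
  have suffix_along {a b : S} (p : ((suffixGraph α n).induce S).Walk a b)
      (ha : x.1 <:+ a.1.1) : x.1 <:+ b.1.1 := by
    induction p with
    | nil => exact ha
    | @cons a b _ hab _ ih =>
      obtain ⟨-, hab | hba⟩ := hab
      · exact ih (ha.trans hab)
      · exact ih (List.suffix_of_suffix_length_le ha hba (not_lt.1 (hmin b b.2)))
  refine ⟨x, hx, fun y hy => ?_⟩
  obtain ⟨p⟩ := hS.preconnected ⟨x, hx⟩ ⟨y, hy⟩
  exact suffix_along p List.suffix_rfl

theorem isContained_of_hasMinorModel_suffixGraph {H : SimpleGraph W}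
    (h : HasMinorModel H (suffixGraph α n)) : H ⊑ suffixGraph α n := by
  obtain ⟨B, hB⟩ := h
  choose top top_mem top_suffix using fun w => exists_suffix_of_connected (hB.connected w)
  have top_injective : Injective top := fun a b hab => by_contra fun hne =>
    (hB.disjoint hne).ne_of_mem (top_mem a) (top_mem b) hab
  refine ⟨⟨⟨top, fun {a b} hab => ⟨top_injective.ne hab.ne, ?_⟩⟩, top_injective⟩⟩
  obtain ⟨x, hx, y, hy, -, hxy | hyx⟩ := hB.exists_adj a b hab
  · exact List.suffix_or_suffix_of_suffix ((top_suffix a x hx).trans hxy) (top_suffix b y hy)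
  · exact List.suffix_or_suffix_of_suffix (top_suffix a x hx) ((top_suffix b y hy).trans hyx)

theorem exists_cons_forall_color_ne [Finite α] {ι : Type*} {c : BoundedWord α n → ι} {d : ℕ}
    {x : BoundedWord α n}
    (hx : {y | (suffixGraph α n).Adj x y ∧ c y = c x}.encard ≤ d) (hd : d < Nat.card α) :
    ∃ a, ∀ y : BoundedWord α n, a :: x.1 <:+ y.1 → c y ≠ c x := by
  by_contra! hcon
  choose y hy hcolor using hcon
  have y_injective : Injective y := fun a b hab => by
    have := List.suffix_of_suffix_length_le (hy a) (hab ▸ hy b) (by simp)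
    exact (List.cons.inj (this.eq_of_length (by simp))).1
  have range_subset : Set.range y ⊆ {y | (suffixGraph α n).Adj x y ∧ c y = c x} := by
    rintro _ ⟨a, rfl⟩
    refine ⟨⟨fun h => ?_, Or.inl ((List.suffix_cons a x.1).trans (hy a))⟩, hcolor a⟩
    have := (hy a).length_le
    simp [← h] at this
  have := (Set.encard_le_encard range_subset).trans hx
  rw [← Set.image_univ, y_injective.encard_image, Set.encard_univ, ENat.card_eq_coe_natCard,
    ENat.natCast_le_natCast] at this
  exact this.not_gt hd

theorem succ_le_length_add_ncard_colors [Finite α] {ι : Type*} [Finite ι]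
    {c : BoundedWord α n → ι} {d : ℕ}
    (hc : ∀ x, {y | (suffixGraph α n).Adj x y ∧ c y = c x}.encard ≤ d) (hd : d < Nat.card α)
    (x : BoundedWord α n) : n + 1 ≤ x.1.length + (c '' {y | x.1 <:+ y.1}).ncard := by
  obtain ⟨a, ha⟩ := exists_cons_forall_color_ne (hc x) hd
  have color_mem : c x ∈ c '' {y | x.1 <:+ y.1} := ⟨x, List.suffix_rfl, rfl⟩
  by_cases hlen : (a :: x.1).length ≤ n
  · have colors_ssubset : c '' {y | a :: x.1 <:+ y.1} ⊂ c '' {y | x.1 <:+ y.1} := by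
      refine (Set.image_mono fun y hy => (List.suffix_cons a x.1).trans hy).ssubset_of_mem_notMem
        color_mem ?_
      rintro ⟨y, hy, hyx⟩
      exact ha y hy hyx
    have := succ_le_length_add_ncard_colors hc hd ⟨a :: x.1, hlen⟩
    have := Set.ncard_lt_ncard colors_ssubset
    simp only [List.length_cons] at *
    omega
  · have := (Set.ncard_pos (Set.toFinite _)).2 ⟨_, color_mem⟩
    simp only [List.length_cons] at hlen
    omega
termination_by n - x.1.length
decreasing_by simp only [List.length_cons] at *; omega

theorem not_defectiveColorable_suffixGraph {α : Type u} [Finite α] {d : ℕ}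
    (hd : d < Nat.card α) : ¬(suffixGraph α n).DefectiveColorable n d := by
  rintro ⟨c, hc⟩
  have length_root : (root α n).1.length = 0 := rfl
  have le_colors := succ_le_length_add_ncard_colors hc hd (root α n)
  have colors_le := Set.ncard_le_card (c '' {y | (root α n).1 <:+ y.1})
  rw [Nat.card_fin] at colors_le
  omega

theorem treeDepth_le_of_isContained_suffixGraph {α V : Type u} [Finite α] {H : SimpleGraph V}
    (h : H ⊑ suffixGraph α n) : H.treeDepth ≤ n + 1 := by
  refine ciSup_le' fun C => (Nat.sInf_le ?_).trans (rootedHeight_tree_le (α := α))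
  have component_isContained : C.toSimpleGraph ⊑ H :=
    ⟨C.toSimpleGraph_hom.toCopy Subtype.val_injective⟩
  exact ⟨_, inferInstance, tree α n, root α n, isTree_tree α n,
    (component_isContained.trans h).mono_right suffixGraph_le_rootedClosure, rfl⟩

end BoundedWord

theorem treeDepth_le_of_forall_defectiveColorable {V : Type u} {H : SimpleGraph V} {k d : ℕ}
    (h : ∀ (W : Type u) [Finite W] (G : SimpleGraph W),
      ¬H.IsMinorOf G → G.DefectiveColorable k d) : H.treeDepth ≤ k + 1 := by
  have isMinorOf : H.IsMinorOf (BoundedWord.suffixGraph (ULift.{u} (Fin (d + 1))) k) :=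
    by_contra fun hH => BoundedWord.not_defectiveColorable_suffixGraph (by simp) (h _ _ hH)
  exact BoundedWord.treeDepth_le_of_isContained_suffixGraph
    (BoundedWord.isContained_of_hasMinorModel_suffixGraph (hasMinorModel_of_isMinorOf isMinorOf))

/-! ### Counting edges -/

theorem mul_ncard_le_two_mul_ncard_edgeSet {V : Type*} [Finite V] {G : SimpleGraph V}
    {s : Set V} {m : ℕ} (h : ∀ v ∈ s, m ≤ (G.neighborSet v).ncard) :
    m * s.ncard ≤ 2 * G.edgeSet.ncard := by
  classical
  have := Fintype.ofFinite V
  calc m * s.ncard = ∑ _v ∈ s.toFinset, m := by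
        rw [Finset.sum_const, smul_eq_mul, mul_comm, Set.ncard_eq_toFinset_card']
    _ ≤ ∑ v ∈ s.toFinset, G.degree v := Finset.sum_le_sum fun v hv => by
        rw [← card_neighborFinset_eq_degree, neighborFinset, ← Set.ncard_eq_toFinset_card']
        exact h v (Set.mem_toFinset.1 hv)
    _ ≤ ∑ v, G.degree v := Finset.sum_le_univ_sum_of_nonneg fun _ => Nat.zero_le _
    _ = 2 * G.edgeSet.ncard := by
        rw [G.sum_degrees_eq_twice_card_edges, Set.ncard_eq_toFinset_card', edgeFinset]

theorem ncard_neighborSet_induce {V : Type*} (G : SimpleGraph V) {s : Set V} (v : s) :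
    ((G.induce s).neighborSet v).ncard = (G.neighborSet v ∩ s).ncard := by
  rw [← Set.ncard_image_of_injective _ Subtype.val_injective, Set.inter_comm,
    ← Subtype.image_preimage_coe]
  rfl

theorem ncard_edgeSet_induce_of_support_subset {V : Type*} [Finite V] {G : SimpleGraph V}
    {s : Set V} (h : G.support ⊆ s) : (G.induce s).edgeSet.ncard = G.edgeSet.ncard := by
  classical
  have := Fintype.ofFinite V
  simpa only [edgeFinset, ← Set.ncard_eq_toFinset_card'] using
    card_edgeFinset_induce_of_support_subset h

theorem ncard_edgeSet_le_ncard_edgeSet_map_add {V W : Type*} [Finite V] [Finite W]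
    (G : SimpleGraph V) {f : V → W} {x y : V}
    (hf : ∀ a b, f a = f b → a = b ∨ s(a, b) = s(x, y)) :
    G.edgeSet.ncard ≤ (G.map f).edgeSet.ncard + ((G.commonNeighbors x y).ncard + 1) := by
  -- Only the edge `xy` and one of the two other edges of each triangle on it are lost.
  set lost := (fun z => s(y, z)) '' insert x (G.commonNeighbors x y)
  have edge_lost : s(x, y) ∈ lost := ⟨x, Or.inl rfl, Sym2.eq_swap⟩
  have triangle_lost {a b z} (hab : s(a, b) = s(x, y)) (haz : G.Adj a z) (hbz : G.Adj b z) :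
      s(a, z) ∈ lost ∨ s(b, z) ∈ lost := by
    obtain ⟨rfl, rfl⟩ | ⟨rfl, rfl⟩ := Sym2.eq_iff.1 hab
    · exact Or.inr ⟨z, Or.inr ⟨haz, hbz⟩, rfl⟩
    · exact Or.inl ⟨z, Or.inr ⟨hbz, haz⟩, rfl⟩
  have mapsTo : ∀ e ∈ G.edgeSet \ lost, e.map f ∈ (G.map f).edgeSet := by
    refine fun e => e.ind fun a b ⟨hab, h⟩ => map_adj_apply' hab fun hfab => ?_
    exact (hf a b hfab).elim hab.ne fun h' => h (h' ▸ edge_lost)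
  have injOn : Set.InjOn (Sym2.map f) (G.edgeSet \ lost) := by
    have eq_of_eq {a b c d} (hab : s(a, b) ∈ G.edgeSet \ lost) (hcd : s(c, d) ∈ G.edgeSet \ lost)
        (hac : f a = f c) (hbd : f b = f d) : s(a, b) = s(c, d) := by
      obtain rfl | hac := hf a c hac <;> obtain rfl | hbd := hf b d hbd
      · rfl
      · rw [Sym2.eq_swap] at hab hcd
        exact (triangle_lost hbd hab.1 hcd.1).elim (absurd · hab.2) (absurd · hcd.2)
      · exact (triangle_lost hac hab.1 hcd.1).elim (absurd · hab.2) (absurd · hcd.2)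
      · have hb : b ∈ s(a, c) := by rw [hac, ← hbd]; exact Sym2.mem_mk_left b d
        obtain rfl | rfl := Sym2.mem_iff.1 hb
        · exact absurd rfl (G.ne_of_adj hab.1)
        · exact absurd (hac ▸ edge_lost) hab.2
    refine fun e => e.ind fun a b hab e' => e'.ind fun c d hcd h => ?_
    obtain ⟨hac, hbd⟩ | ⟨had, hbc⟩ := Sym2.eq_iff.1 h
    · exact eq_of_eq hab hcd hac hbd
    · rw [Sym2.eq_swap (a := c)] at hcd ⊢
      exact eq_of_eq hab hcd had hbc
  calc G.edgeSet.ncard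
      ≤ (G.edgeSet \ lost).ncard + lost.ncard := Set.ncard_le_ncard_sdiff_add_ncard _ _
    _ ≤ (G.map f).edgeSet.ncard + ((G.commonNeighbors x y).ncard + 1) := by
      gcongr
      · exact Set.ncard_le_ncard_of_injOn _ mapsTo injOn
      · exact (Set.ncard_image_le (Set.toFinite _)).trans (Set.ncard_insert_le _ _)

/-! ### Star contractions -/

/-- Contracting, for every `v`, the edge from `v` to `f v` turns `G` into
`(G.map f).induce (fixedPoints f)`, provided that no vertex outside `A` is moved. The contracted
subgraph consists of disjoint stars centred at the fixed points of `f`; a vertex moved to a moved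
vertex is deleted. -/
def IsStarContraction {V : Type*} (G : SimpleGraph V) (A : Set V) (f : V → V) : Prop :=
  ∀ v, f v = v ∨ v ∈ A ∧ G.Adj v (f v)

namespace IsStarContraction

variable {V : Type*} {G : SimpleGraph V} {A : Set V} {f : V → V}

theorem id (G : SimpleGraph V) (A : Set V) : IsStarContraction G A id := fun _ => Or.inl rfl

theorem update [DecidableEq V] (hf : IsStarContraction G A f) {v x : V} (hv : v ∈ A)
    (hvx : G.Adj v x) : IsStarContraction G A (Function.update f v x) := by
  intro w
  obtain rfl | hw := eq_or_ne w v
  · exact Or.inr ⟨hv, by rwa [Function.update_self]⟩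
  · rw [Function.update_of_ne hw]
    exact hf w

theorem compl_subset_fixedPoints (hf : IsStarContraction G A f) : Aᶜ ⊆ fixedPoints f :=
  fun v hv => (hf v).resolve_right fun h => hv h.1

theorem hasMinorModel (hf : IsStarContraction G A f) :
    HasMinorModel ((G.map f).induce (fixedPoints f)) G := by
  refine ⟨fun y => f ⁻¹' {y.1}, fun y => ?_, fun x y hxy => ?_, fun x y hxy => ?_⟩
  · refine connected_induce_of_forall_adj (x := y.1) y.2 fun v (hv : f v = y) => ?_
    exact (hf v).imp (fun h => h.symm.trans hv) fun h => (hv ▸ h.2).symm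
  · exact Disjoint.preimage f (Set.disjoint_singleton.2 (Subtype.val_injective.ne hxy))
  · obtain ⟨-, v, w, hvw, hv, hw⟩ := hxy
    exact ⟨v, hv, w, hw, hvw⟩

end IsStarContraction

/-! ### Mader's theorem -/

theorem exists_edge_contraction {V : Type*} [Finite V] {G : SimpleGraph V} {x y : V}
    (hxy : G.Adj x y) : ∃ G' : SimpleGraph ({y}ᶜ : Set V), HasMinorModel G' G ∧
      G.edgeSet.ncard ≤ G'.edgeSet.ncard + ((G.commonNeighbors x y).ncard + 1) := by
  classical
  set f := Function.update id y x with hf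
  have f_apply (v : V) : f v = if v = y then x else v := Function.update_apply _ _ _ _
  have f_ne (v : V) : f v ≠ y := by
    rw [f_apply]
    split_ifs with h
    exacts [hxy.ne, h]
  have hmodel := ((IsStarContraction.id G {y}).update rfl hxy.symm).hasMinorModel
  have compl_subset : ({y}ᶜ : Set V) ⊆ fixedPoints f := fun v hv => Function.update_of_ne hv _ _
  have support_subset : (G.map f).support ⊆ {y}ᶜ := by
    rintro _ ⟨_, -, v, -, -, rfl, -⟩
    exact f_ne v
  refine ⟨(G.map f).induce {y}ᶜ, HasMinorModel.trans (.of_isContained ?_) hmodel, ?_⟩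
  · exact ⟨(induceHomOfLE _ compl_subset).toCopy⟩
  · rw [ncard_edgeSet_induce_of_support_subset support_subset]
    refine ncard_edgeSet_le_ncard_edgeSet_map_add G fun a b hab => ?_
    simp only [f_apply] at hab
    split_ifs at hab with ha hb hb
    all_goals subst_vars
    · exact Or.inl rfl
    · exact Or.inr Sym2.eq_swap
    · exact Or.inr rfl
    · exact Or.inl rfl

/-- Contract edges lying in few triangles until every edge lies in many, and then recurse into the
neighbourhood of a vertex. -/
theorem hasMinorModel_top_of_le_ncard_edgeSet (W : Type*) [Finite W] :
    ∀ {V : Type u} [Finite V] [Nonempty V] {G : SimpleGraph V},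
      2 ^ Nat.card W * Nat.card V ≤ G.edgeSet.ncard → HasMinorModel (⊤ : SimpleGraph W) G := by
  induction W using Finite.induction_empty_option with
  | of_equiv e ih =>
    intro V _ _ G h
    rw [← Nat.card_congr e] at h
    exact .trans (.of_isContained ⟨(Iso.completeGraph e.symm).toCopy⟩) (ih h)
  | h_empty => exact fun _ => .of_isContained .of_isEmpty
  | @h_option W _ ih =>
    intro V _ _ G h
    induction hn : Nat.card V using Nat.strong_induction_on generalizing V with | _ n ihV
    subst hn
    rw [Finite.card_option] at h ihV
    by_cases hlow : ∃ x y, G.Adj x y ∧ (G.commonNeighbors x y).ncard < 2 ^ (Nat.card W + 1)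
    · obtain ⟨x, y, hxy, hlt⟩ := hlow
      obtain ⟨G', hG', hle⟩ := exists_edge_contraction hxy
      have : Nonempty ({y}ᶜ : Set V) := ⟨x, hxy.ne⟩
      have hcard : Nat.card ({y}ᶜ : Set V) + 1 = Nat.card V := by
        rw [Nat.card_coe_set_eq, add_comm, ← Set.ncard_singleton y, Set.ncard_add_ncard_compl]
      refine (ihV _ (by omega) ?_ rfl).trans hG'
      rw [← hcard, mul_add] at h
      omega
    · push Not at hlow
      obtain ⟨e, he⟩ : G.edgeSet.Nonempty := (Set.ncard_pos (Set.toFinite _)).1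
        ((Nat.mul_pos (by positivity) Nat.card_pos).trans_le h)
      induction e with | _ x y
      have : Nonempty (G.neighborSet x) := ⟨y, he⟩
      have le_degree (v : G.neighborSet x) (_ : v ∈ Set.univ) :
          2 ^ (Nat.card W + 1) ≤ ((G.induce (G.neighborSet x)).neighborSet v).ncard := by
        rw [ncard_neighborSet_induce, Set.inter_comm]
        exact hlow x v v.2
      refine HasMinorModel.of_induce_neighborSet (x := x) (ih ?_)
      have := mul_ncard_le_two_mul_ncard_edgeSet le_degree
      rw [Set.ncard_univ, pow_succ] at this
      linarith

theorem ncard_edgeSet_le_of_not_hasMinorModel {W : Type*} [Finite W] {V : Type u} [Finite V]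
    {H : SimpleGraph W} {G : SimpleGraph V} (h : ¬HasMinorModel H G) :
    G.edgeSet.ncard ≤ 2 ^ Nat.card W * Nat.card V := by
  cases isEmpty_or_nonempty V
  · simp [Subsingleton.elim G ⊥]
  · by_contra! hlt
    exact h (.trans (.of_isContained (.of_le le_top))
      (hasMinorModel_top_of_le_ncard_edgeSet W hlt.le))

/-! ### Degeneracy and cliques -/

/-- Every nonempty subgraph of `J` induced by a subset of `X` has a vertex of degree at most `D`. -/
def IsDegenerateOn {V : Type*} (J : SimpleGraph V) (D : ℕ) (X : Set V) : Prop :=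
  ∀ Y ⊆ X, Y.Nonempty → ∃ v ∈ Y, (J.neighborSet v ∩ Y).ncard ≤ D

theorem isDegenerateOn_of_not_hasMinorModel {W : Type*} [Finite W] {V : Type u} [Finite V]
    {H : SimpleGraph W} {J : SimpleGraph V} {X : Set V} (h : ¬HasMinorModel H (J.induce X)) :
    IsDegenerateOn J (2 * 2 ^ Nat.card W) X := by
  intro Y hYX hY
  by_contra! hdeg
  have edges_le := ncard_edgeSet_le_of_not_hasMinorModel fun hY => h (hY.induce_mono hYX)
  have le_degree (v : Y) (_ : v ∈ Set.univ) :
      2 * 2 ^ Nat.card W + 1 ≤ ((J.induce Y).neighborSet v).ncard := by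
    rw [ncard_neighborSet_induce]
    exact hdeg v v.2
  have le_edges := mul_ncard_le_two_mul_ncard_edgeSet le_degree
  rw [Set.ncard_univ] at le_edges
  have : 0 < Nat.card Y := hY.ncard_pos
  linarith

theorem IsDegenerateOn.ncard_isClique_le {V : Type*} [Finite V] {J : SimpleGraph V} {D : ℕ}
    {X : Set V} (hJ : IsDegenerateOn J D X) :
    {Q | Q ⊆ X ∧ Q.Nonempty ∧ J.IsClique Q}.ncard ≤ 2 ^ D * X.ncard := by
  induction hn : X.ncard generalizing X with
  | zero =>
    obtain rfl := (Set.ncard_eq_zero (Set.toFinite X)).1 hn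
    refine ((Set.ncard_eq_zero (Set.toFinite _)).2 ?_).le
    exact Set.eq_empty_of_forall_notMem fun Q hQ => hQ.2.1.ne_empty (Set.subset_empty_iff.1 hQ.1)
  | succ n ih =>
    obtain ⟨v, hv, hD⟩ := hJ X subset_rfl (Set.nonempty_of_ncard_ne_zero (by omega))
    have cliques_avoiding := ih (X := X \ {v})
      (fun Y hY => hJ Y (hY.trans Set.sdiff_subset))
      (by rw [Set.ncard_sdiff_singleton_of_mem hv, hn, Nat.add_sub_cancel])
    have cliques_containing : (insert v '' 𝒫 (J.neighborSet v ∩ X)).ncard ≤ 2 ^ D := by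
      refine (Set.ncard_image_le (Set.toFinite _)).trans ?_
      rw [Set.ncard_powerset _ (Set.toFinite _)]
      exact Nat.pow_le_pow_right two_pos hD
    have cover : {Q | Q ⊆ X ∧ Q.Nonempty ∧ J.IsClique Q} ⊆
        {Q | Q ⊆ X \ {v} ∧ Q.Nonempty ∧ J.IsClique Q} ∪ insert v '' 𝒫 (J.neighborSet v ∩ X) := by
      rintro Q ⟨hQX, hne, hQ⟩
      by_cases hvQ : v ∈ Q
      · exact Or.inr ⟨Q \ {v}, fun w hw => ⟨hQ hvQ hw.1 (Ne.symm hw.2), hQX hw.1⟩,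
          Set.insert_sdiff_self_of_mem hvQ⟩
      · exact Or.inl ⟨Set.subset_sdiff_singleton hQX hvQ, hne, hQ⟩
    calc {Q | Q ⊆ X ∧ Q.Nonempty ∧ J.IsClique Q}.ncard
        ≤ 2 ^ D * n + 2 ^ D := (Set.ncard_le_ncard cover).trans
          ((Set.ncard_union_le _ _).trans (add_le_add cliques_avoiding cliques_containing))
      _ = 2 ^ D * (n + 1) := by ring

theorem ncard_le_mul_ncard_of_mapsTo {α β : Type*} [Finite α] [Finite β] {f : α → β} {s : Set α}
    {t : Set β} {n : ℕ} (hf : Set.MapsTo f s t) (hn : ∀ b ∈ t, (s ∩ f ⁻¹' {b}).ncard ≤ n) :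
    s.ncard ≤ n * t.ncard := by
  classical
  have := Fintype.ofFinite α
  have := Fintype.ofFinite β
  rw [Set.ncard_eq_toFinset_card' s, Set.ncard_eq_toFinset_card' t]
  refine Finset.card_le_mul_card_image_of_maps_to (f := f)
    (fun a ha => Set.mem_toFinset.2 (hf (Set.mem_toFinset.1 ha))) n fun b hb => ?_
  refine (hn b (Set.mem_toFinset.1 hb)).trans' (le_of_eq ?_)
  rw [Set.ncard_eq_toFinset_card']
  congr 1
  ext a
  simp

/-! ### Light edges -/

theorem isContained_induce_union_of_isVertexCover {V W : Type*} [Finite V] [Finite W]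
    {H : SimpleGraph W} {J : SimpleGraph V} {C : Set W} {Q F : Set V}
    (hC : H.IsVertexCover C) (hQ : J.IsClique Q)
    (hQF : ∀ x ∈ Q, ∀ y ∈ F, J.Adj x y) (hCQ : C.ncard ≤ Q.ncard) (hF : Nat.card W ≤ F.ncard) :
    H ⊑ J.induce (Q ∪ F) := by
  classical
  obtain _ | _ := isEmpty_or_nonempty W
  · exact .of_isEmpty
  have : Nonempty V :=
    (Set.nonempty_of_ncard_ne_zero (Nat.card_pos.trans_le hF).ne').to_type
  have exists_injOn {s : Set W} {t : Set V} (h : s.ncard ≤ t.ncard) :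
      ∃ f : W → V, s ⊆ f ⁻¹' t ∧ Set.InjOn f s := by
    refine (Set.toFinite s).exists_injOn_of_encard_le ?_
    rw [← (Set.toFinite s).cast_ncard_eq, ← (Set.toFinite t).cast_ncard_eq]
    exact_mod_cast h
  obtain ⟨g, hgQ, hg⟩ := exists_injOn hCQ
  obtain ⟨h, hhF, hh⟩ := exists_injOn (s := Cᶜ) ((Set.ncard_le_card _).trans hF)
  have hgh : Function.Injective (C.piecewise g h) := Set.injective_piecewise_iff _ |>.2
    ⟨hg, hh, fun x hx y hy => (hQF _ (hgQ hx) _ (hhF hy)).ne⟩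
  have mem_Q {w} (hw : w ∈ C) : C.piecewise g h w ∈ Q := by
    rw [Set.piecewise_eq_of_mem C g h hw]
    exact hgQ hw
  have mem_F {w} (hw : w ∉ C) : C.piecewise g h w ∈ F := by
    rw [Set.piecewise_eq_of_notMem C g h hw]
    exact hhF hw
  have mem_union (w : W) : C.piecewise g h w ∈ Q ∪ F :=
    (em (w ∈ C)).imp mem_Q mem_F
  refine ⟨⟨⟨fun w => ⟨C.piecewise g h w, mem_union w⟩, fun {a b} hab => ?_⟩,
    fun a b hab => hgh (congrArg Subtype.val hab)⟩⟩
  change J.Adj (C.piecewise g h a) (C.piecewise g h b)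
  by_cases ha : a ∈ C <;> by_cases hb : b ∈ C
  · exact hQ (mem_Q ha) (mem_Q hb) (hgh.ne hab.ne)
  · exact hQF _ (mem_Q ha) _ (mem_F hb)
  · exact (hQF _ (mem_Q hb) _ (mem_F ha)).symm
  · exact absurd (hC hab) (not_or.2 ⟨ha, hb⟩)

theorem exists_isStarContraction_isClique {V : Type*} [Finite V] {G : SimpleGraph V} {A : Set V}
    (hA : G.IsIndepSet A) : ∃ f, IsStarContraction G A f ∧
      {v | f v ≠ v}.ncard ≤ ((G.map f).induce Aᶜ).edgeSet.ncard ∧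
      ∀ v ∈ A, f v = v → (G.map f).IsClique (G.neighborSet v) := by
  classical
  obtain ⟨f, ⟨hf, hle⟩, hmax⟩ := Set.Finite.exists_maximalFor (fun f : V → V => {v | f v ≠ v}.ncard)
    {f | IsStarContraction G A f ∧
      {v | f v ≠ v}.ncard ≤ ((G.map f).induce Aᶜ).edgeSet.ncard}
    (Set.toFinite _) ⟨id, .id G A, by simp⟩
  refine ⟨f, hf, hle, fun v hv hfv x hx y hy hxy => ?_⟩
  by_contra hnew
  have notMem {z} (hz : G.Adj v z) : z ∉ A := fun hzA => hA hv hzA hz.ne hz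
  have moved : {w | Function.update f v x w ≠ w} = insert v {w | f w ≠ w} := by
    ext w
    obtain rfl | hw := eq_or_ne w v
    · simp [hx.ne']
    · simp [hw]
  have moved_ncard : {w | Function.update f v x w ≠ w}.ncard = {w | f w ≠ w}.ncard + 1 := by
    have hv : v ∉ {w | f w ≠ w} := not_not_intro hfv
    rw [moved, Set.ncard_insert_of_notMem hv]
  have edges_lt : ((G.map f).induce Aᶜ).edgeSet.ncard <
      ((G.map (Function.update f v x)).induce Aᶜ).edgeSet.ncard := by
    have mono : (G.map f).induce Aᶜ ≤ (G.map (Function.update f v x)).induce Aᶜ := by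
      rintro ⟨_, ha⟩ ⟨_, hb⟩ ⟨hne, a, b, hab, rfl, rfl⟩
      have av : a ≠ v := fun h => ha (by rwa [h, hfv])
      have bv : b ≠ v := fun h => hb (by rwa [h, hfv])
      exact ⟨hne, a, b, hab, Function.update_of_ne av _ _, Function.update_of_ne bv _ _⟩
    refine Set.ncard_lt_ncard (edgeSet_ssubset_edgeSet.2 (mono.lt_of_not_ge fun h => hnew ?_))
    have hxy' : (G.map (Function.update f v x)).Adj x y := by
      refine ⟨hxy, v, y, hy, Function.update_self _ _ _, ?_⟩
      rw [Function.update_of_ne hy.ne']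
      exact hf.compl_subset_fixedPoints (notMem hy)
    exact h (show ((G.map (Function.update f v x)).induce Aᶜ).Adj ⟨x, notMem hx⟩ ⟨y, notMem hy⟩
      from hxy')
  have := hmax ⟨hf.update hv hx, by omega⟩
  dsimp only at this
  omega

theorem ncard_le_of_isIndepSet {W : Type*} [Finite W] {V : Type u} [Finite V] {H : SimpleGraph W}
    {C : Set W} (hC : H.IsVertexCover C) (hCne : C.Nonempty) {G : SimpleGraph V}
    (hG : ¬HasMinorModel H G) {A : Set V} (hA : G.IsIndepSet A)
    (hdeg : ∀ v ∈ A, C.ncard ≤ (G.neighborSet v).ncard) :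
    A.ncard ≤ (2 ^ Nat.card W + Nat.card W * 2 ^ (2 * 2 ^ Nat.card W)) * Aᶜ.ncard := by
  set t := Nat.card W
  obtain ⟨f, hf, moved_le, clique⟩ := exists_isStarContraction_isClique hA
  have not_hasMinorModel {Y : Set V} (hY : Y ⊆ fixedPoints f) :
      ¬HasMinorModel H ((G.map f).induce Y) :=
    fun h => hG ((h.induce_mono hY).trans hf.hasMinorModel)
  have moved_ncard : {v | f v ≠ v}.ncard ≤ 2 ^ t * Aᶜ.ncard :=
    moved_le.trans (ncard_edgeSet_le_of_not_hasMinorModel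
      (not_hasMinorModel hf.compl_subset_fixedPoints))
  have neighborSet_mapsTo : Set.MapsTo G.neighborSet (A ∩ fixedPoints f)
      {Q | Q ⊆ Aᶜ ∧ Q.Nonempty ∧ (G.map f).IsClique Q} := fun v hv =>
    ⟨fun w hvw hw => hA hv.1 hw hvw.ne hvw,
      Set.nonempty_of_ncard_ne_zero (hCne.ncard_pos.trans_le (hdeg v hv.1)).ne',
      clique v hv.1 hv.2⟩
  have fiber_ncard : ∀ Q ∈ {Q | Q ⊆ Aᶜ ∧ Q.Nonempty ∧ (G.map f).IsClique Q},
      (A ∩ fixedPoints f ∩ G.neighborSet ⁻¹' {Q}).ncard ≤ t := by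
    rintro Q ⟨hQA, -, hQ⟩
    by_contra! hlt
    obtain ⟨v, hv, rfl⟩ := Set.nonempty_of_ncard_ne_zero (Nat.ne_zero_of_lt hlt)
    refine not_hasMinorModel (Set.union_subset (hQA.trans hf.compl_subset_fixedPoints)
      fun w hw => hw.1.2) (.of_isContained (isContained_induce_union_of_isVertexCover hC hQ
        (fun x hx w hw => ?_) (hdeg v hv.1) hlt.le))
    have hwx : G.Adj w x := by rwa [← mem_neighborSet, hw.2]
    exact ⟨hwx.ne', x, w, hwx.symm, hf.compl_subset_fixedPoints (hQA hx), hw.1.2⟩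
  have fixed_ncard : (A ∩ fixedPoints f).ncard ≤ t * (2 ^ (2 * 2 ^ t) * Aᶜ.ncard) :=
    (ncard_le_mul_ncard_of_mapsTo neighborSet_mapsTo fiber_ncard).trans <|
      Nat.mul_le_mul_left t (isDegenerateOn_of_not_hasMinorModel
        (not_hasMinorModel hf.compl_subset_fixedPoints)).ncard_isClique_le
  have cover : A ⊆ {v | f v ≠ v} ∪ A ∩ fixedPoints f := fun v hv =>
    (em (f v = v)).symm.imp_right fun h => ⟨hv, h⟩
  calc A.ncard ≤ 2 ^ t * Aᶜ.ncard + t * (2 ^ (2 * 2 ^ t) * Aᶜ.ncard) :=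
        (Set.ncard_le_ncard cover).trans
          ((Set.ncard_union_le _ _).trans (add_le_add moved_ncard fixed_ncard))
    _ = (2 ^ t + t * 2 ^ (2 * 2 ^ t)) * Aᶜ.ncard := by ring

/-- An edge is light when both its ends have degree at most `lightDegree t`, where `t` is the order
of the excluded minor: `2 ^ t` bounds the ratio of edges to vertices, and the second factor the
ratio of all vertices to vertices of larger degree. -/
def lightDegree (t : ℕ) : ℕ :=
  2 * 2 ^ t * (1 + 2 ^ t + t * 2 ^ (2 * 2 ^ t))

theorem exists_ncard_neighborSet_lt_or_exists_light_edge {W : Type*} [Finite W] {V : Type u}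
    [Finite V] [Nonempty V] {H : SimpleGraph W} {C : Set W} (hC : H.IsVertexCover C)
    (hCne : C.Nonempty) {G : SimpleGraph V} (hG : ¬HasMinorModel H G) :
    (∃ v, (G.neighborSet v).ncard < C.ncard) ∨
      ∃ x y, G.Adj x y ∧ (G.neighborSet x).ncard ≤ lightDegree (Nat.card W) ∧
        (G.neighborSet y).ncard ≤ lightDegree (Nat.card W) := by
  by_contra! hcon
  obtain ⟨le_degree, heavy⟩ := hcon
  set t := Nat.card W
  set A := {v | (G.neighborSet v).ncard ≤ lightDegree t}
  have hA : G.IsIndepSet A := fun x hx y hy _ hxy => (heavy x y hxy hx).not_ge hy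
  have A_ncard := ncard_le_of_isIndepSet hC hCne hG hA fun v _ => le_degree v
  have edges_le : G.edgeSet.ncard ≤ 2 ^ t * (A.ncard + Aᶜ.ncard) := by
    rw [Set.ncard_add_ncard_compl]
    exact ncard_edgeSet_le_of_not_hasMinorModel hG
  have le_edges : (lightDegree t + 1) * Aᶜ.ncard ≤ 2 * G.edgeSet.ncard :=
    mul_ncard_le_two_mul_ncard_edgeSet fun v (hv : ¬(G.neighborSet v).ncard ≤ lightDegree t) =>
      not_le.1 hv
  have compl_ncard : (lightDegree t + 1) * Aᶜ.ncard ≤ lightDegree t * Aᶜ.ncard :=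
    calc (lightDegree t + 1) * Aᶜ.ncard
        ≤ 2 * (2 ^ t * (A.ncard + Aᶜ.ncard)) := by omega
      _ ≤ 2 * (2 ^ t * ((2 ^ t + t * 2 ^ (2 * 2 ^ t)) * Aᶜ.ncard + Aᶜ.ncard)) := by gcongr
      _ = lightDegree t * Aᶜ.ncard := by rw [lightDegree]; ring
  have compl_eq_zero : Aᶜ.ncard = 0 := by linarith
  have A_eq_zero : A.ncard = 0 := by simpa [compl_eq_zero] using A_ncard
  have := Set.ncard_add_ncard_compl A
  have : 0 < Nat.card V := Nat.card_pos
  omega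

/-! ### Colouring -/

theorem defectiveColorable_of_induce_compl {V : Type u} [Finite V] {G : SimpleGraph V} {k d : ℕ}
    {v : V} (hv : (G.neighborSet v).ncard < k) (h : (G.induce {v}ᶜ).DefectiveColorable k d) :
    G.DefectiveColorable k d := by
  obtain ⟨c, hc⟩ := h
  obtain ⟨i, hi⟩ : ∃ i, i ∉ c '' (Subtype.val ⁻¹' G.neighborSet v) := by
    by_contra! hall
    have image_le : (c '' (Subtype.val ⁻¹' G.neighborSet v)).ncard ≤ (G.neighborSet v).ncard :=
      (Set.ncard_image_le (Set.toFinite _)).trans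
        (Set.ncard_le_ncard_of_injOn Subtype.val (fun _ => id) Subtype.val_injective.injOn)
    rw [Set.eq_univ_of_forall hall, Set.ncard_univ, Nat.card_fin] at image_le
    omega
  set c' : V → Fin k := Function.extend Subtype.val c fun _ => i
  have c'_apply (w : ({v}ᶜ : Set V)) : c' w = c w := Subtype.val_injective.extend_apply _ _ w
  have c'_self : c' v = i := Function.extend_apply' _ _ _ fun ⟨w, hw⟩ => w.2 hw
  have c'_ne {w} (hw : G.Adj v w) : c' w ≠ i := fun h =>
    hi ⟨⟨w, hw.ne'⟩, hw, (c'_apply _).symm.trans h⟩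
  refine ⟨c', fun w => ?_⟩
  obtain rfl | hwv := eq_or_ne w v
  · have no_conflict : {x | G.Adj w x ∧ c' x = c' w} = ∅ :=
      Set.eq_empty_of_forall_notMem fun x hx => c'_ne hx.1 (hx.2.trans c'_self)
    rw [no_conflict, Set.encard_empty]
    exact zero_le
  · refine (Set.encard_le_encard ?_).trans
      ((Subtype.val_injective.encard_image _).trans_le (hc ⟨w, hwv⟩))
    rintro x ⟨hwx, hcx⟩
    have hxv : x ≠ v := by
      rintro rfl
      exact c'_ne hwx.symm (hcx.symm.trans c'_self)
    refine ⟨⟨x, hxv⟩, ⟨hwx, ?_⟩, rfl⟩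
    rwa [← c'_apply, ← c'_apply]

theorem defectiveColorable_of_deleteEdges {V : Type u} [Finite V] {G : SimpleGraph V} {k d : ℕ}
    {x y : V} (hx : (G.neighborSet x).ncard ≤ d) (hy : (G.neighborSet y).ncard ≤ d)
    (h : (G.deleteEdges {s(x, y)}).DefectiveColorable k d) : G.DefectiveColorable k d := by
  obtain ⟨c, hc⟩ := h
  refine ⟨c, fun v => ?_⟩
  by_cases hv : v ∈ s(x, y)
  · have hvd : (G.neighborSet v).ncard ≤ d := by
      obtain rfl | rfl := Sym2.mem_iff.1 hv
      exacts [hx, hy]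
    calc {w | G.Adj v w ∧ c w = c v}.encard ≤ (G.neighborSet v).encard :=
          Set.encard_le_encard fun w hw => hw.1
      _ ≤ d := by
          rw [← (Set.toFinite (G.neighborSet v)).cast_ncard_eq]
          exact_mod_cast hvd
  · refine (Set.encard_le_encard ?_).trans (hc v)
    rintro w ⟨hvw, hcw⟩
    exact ⟨deleteEdges_adj.2 ⟨hvw, fun h => hv (h ▸ Sym2.mem_mk_left v w)⟩, hcw⟩

theorem defectiveColorable_of_isVertexCover {W : Type*} [Finite W] {H : SimpleGraph W} {C : Set W}
    (hC : H.IsVertexCover C) (hCne : C.Nonempty) {V : Type u} [Finite V] (G : SimpleGraph V)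
    (hG : ¬HasMinorModel H G) : G.DefectiveColorable C.ncard (lightDegree (Nat.card W)) := by
  induction hn : Nat.card V using Nat.strong_induction_on generalizing V with | _ n ihV
  subst hn
  induction G using WellFoundedLT.induction with | _ G ihG
  obtain _ | _ := isEmpty_or_nonempty V
  · exact ⟨isEmptyElim, isEmptyElim⟩
  obtain ⟨v, hv⟩ | ⟨x, y, hxy, hx, hy⟩ :=
    exists_ncard_neighborSet_lt_or_exists_light_edge hC hCne hG
  · refine defectiveColorable_of_induce_compl hv (ihV _ ?_ _ (fun h => hG ?_) rfl)
    · rw [Nat.card_coe_set_eq]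
      exact Set.ncard_lt_card fun h => (h ▸ Set.mem_univ v : v ∈ ({v}ᶜ : Set V)) rfl
    · exact h.trans (.of_isContained ⟨Copy.induce G _⟩)
  · refine defectiveColorable_of_deleteEdges hx hy (ihG _ ?_ fun h => hG ?_)
    · exact (G.deleteEdges_le _).lt_of_not_ge fun h => (deleteEdges_adj.1 (h hxy)).2 rfl
    · exact h.trans (.of_isContained (.of_le (G.deleteEdges_le _)))

theorem isEmpty_of_not_isMinorOf {V W : Type u} [Subsingleton V] {H : SimpleGraph V}
    {G : SimpleGraph W} (h : ¬H.IsMinorOf G) : IsEmpty W := by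
  refine ⟨fun w => h (HasMinorModel.isMinorOf (.of_isContained ?_))⟩
  exact ⟨⟨fun _ => w, fun hab => absurd (Subsingleton.elim _ _) hab.ne⟩,
    injective_of_subsingleton _⟩

theorem mainTheorem10 {V : Type u} [Finite V] (H : SimpleGraph V) :
    ∃ f : ℕ, IsDefectiveChromaticNumber (minorFreeClass H) f ∧
      (H.treeDepth : ℤ) - 1 ≤ (f : ℤ) ∧
      ((H ≠ ⊥ ∨ Nat.card V ≤ 1) → (f : ℕ∞) ≤ H.vertexCoverNum) := by
  set K := {k : ℕ | ∃ d : ℕ, ∀ (W : Type u) [Finite W] (G : SimpleGraph W),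
    minorFreeClass H W G → G.DefectiveColorable k d}
  have ncard_mem {C : Set V} (hC : H.IsVertexCover C) (hCne : C.Nonempty) : C.ncard ∈ K :=
    ⟨_, fun W _ G hG => defectiveColorable_of_isVertexCover hC hCne G
      fun h => hG h.isMinorOf⟩
  have zero_mem (_ : Subsingleton V) : 0 ∈ K := ⟨0, fun W _ G hG =>
    have := isEmpty_of_not_isMinorOf hG
    ⟨isEmptyElim, isEmptyElim⟩⟩
  have K_nonempty : K.Nonempty := (subsingleton_or_nontrivial V).elim (fun h => ⟨0, zero_mem h⟩)
    fun _ => ⟨_, ncard_mem isVertexCover_univ Set.univ_nonempty⟩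
  refine ⟨sInf K, ⟨Nat.sInf_mem K_nonempty, fun _ => Nat.sInf_le⟩, ?_, ?_⟩
  · obtain ⟨d, hd⟩ := Nat.sInf_mem K_nonempty
    have := treeDepth_le_of_forall_defectiveColorable hd
    omega
  · obtain ⟨C, hC_encard, hC⟩ := H.vertexCoverNum_exists
    obtain _ | _ := subsingleton_or_nontrivial V
    · simp [Nat.sInf_eq_zero.2 (Or.inl (zero_mem ‹_›))]
    · intro h
      have hCne : C.Nonempty := Set.encard_ne_zero.1 (hC_encard ▸
        vertexCoverNum_eq_zero.not.2 (h.resolve_right (not_le.2 Finite.one_lt_card)))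
      rw [← hC_encard, ← (Set.toFinite C).cast_ncard_eq]
      exact_mod_cast Nat.sInf_le (ncard_mem hC hCne)
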